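/- Let $q$ be a prime power, let $n\ge 2$ and let $0\le k\le n-1$ be integers. For $\alpha\in\mathbb F_{q^n}$ let $V_\alpha$ be the $\mathbb F_q$-subspace of $\mathbb F_{q^n}$ generated by $\alpha,\alpha^q,\dots,\alpha^{q^{n-1}}$; the element $\alpha$ is called $k$-normal over $\mathbb F_q$ if $\dim_{\mathbb F_q}V_\alpha=n-k$. Suppose that $\mathbb F_{q^n}$ contains a $k$-normal element over $\mathbb F_q$. Then there exists a $k$-normal element $\alpha\in\mathbb F_{q^n}^*$ whose multiplicative order is at least $$\tau(k,q,n):=4^{(k-n)/q}\cdot q^{\,n-k-\frac{1.1\,n}{\log\log(q^n-1)}},$$ where $\log$ is the natural logarithm. -/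

import Mathlib

/-- For an extension `L / K` of degree `n` with `K` of cardinality `q`: the `K`-subspace of `L`
spanned by `α, α ^ q, …, α ^ (q ^ (n - 1))`. -/
def conjugateSpan (K : Type*) {L : Type*} [Field K] [Field L] [Algebra K L] (α : L) :
    Submodule K L :=
  Submodule.span K
    (Set.range fun i : Fin (Module.finrank K L) => α ^ (Nat.card K ^ (i : ℕ)))

/-- `α` is `k`-normal over `K`: the span of its conjugates has dimension `n - k`, where
`n = [L : K]` (written additively, to avoid truncated subtraction). -/
def IsKNormal (K : Type*) {L : Type*} [Field K] [Field L] [Algebra K L] (k : ℕ) (α : L) : Prop :=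
  Module.finrank K (conjugateSpan K α) + k = Module.finrank K L

/-- `τ(k, q, n) = 4 ^ ((k - n) / q) * q ^ (n - k - 1.1 n / log log (q ^ n - 1))`,
with all operations in `ℝ`. -/
noncomputable def kNormalOrderBound (k q n : ℕ) : ℝ :=
  (4 : ℝ) ^ (((k : ℝ) - (n : ℝ)) / (q : ℝ)) *
    (q : ℝ) ^ ((n : ℝ) - (k : ℝ) - 1.1 * (n : ℝ) / Real.log (Real.log ((q : ℝ) ^ n - 1)))

/-! Let `X` act on `L` as the Frobenius `φ`. If `β` is `k`-normal, its annihilator in `K[X]` is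
generated by some `h` of degree `n - k`, and `f(φ) β` is again `k`-normal for each residue `f`
coprime to `h`, distinct residues giving distinct elements. There are at least `(q - 1) ^ (n - k)`
such residues (`sub_one_pow_le_ncard_coprimeResidues`), hence as many `k`-normal elements
(`sub_one_pow_le_ncard_isKNormal`).

If all of them had order below `τ`, cyclicity of `Lˣ` would leave fewer than `τ * d(q ^ n - 1)` of
them (`IsCyclic.card_lt_mul_card_divisors`). This is contradicted by `(1 - 1/q) ^ q ≥ 1/4` together
with `d(m) ≤ m ^ (1.1 / log log m)` for `m ≥ 3` (`log_card_divisors_le_div_log_log`).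

The divisor bound is Rankin's trick: `log d(m) - δ log m` is at most the sum over primes `p` of the
maximum over `a` of `log (a + 1) - a δ log p`. For `log m ≤ 1776` the values `δ = 1/3, 1/4, 1/5,
1/7` suffice, with maximisers verified in integers. Beyond that, `δ = 1 / (log log m + 1)`, and the
only input on primes is that they are odd apart from `2`. -/

/-! ### Lower bound for the polynomial totient. -/

section CoprimeCount

open Polynomial

variable {K : Type*} [Field K]

/-- The residues modulo `h` of degree less than `natDegree h` that are coprime to `h`. -/
def coprimeResidues (h : K[X]) : Set K[X] :=
  {f | f ∈ degreeLT K h.natDegree ∧ IsCoprime f h}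

theorem finrank_degreeLT (n : ℕ) : Module.finrank K (degreeLT K n) = n := by
  rw [(degreeLTEquiv K n).finrank_eq, Module.finrank_fin_fun]

theorem finite_degreeLT [Finite K] (n : ℕ) : (degreeLT K n : Set K[X]).Finite := by
  have : Finite (degreeLT K n) := Finite.of_equiv _ (degreeLTEquiv K n).toEquiv.symm
  exact Set.toFinite _

theorem ncard_degreeLT [Finite K] (n : ℕ) :
    (degreeLT K n : Set K[X]).ncard = Nat.card K ^ n := by
  rw [← Nat.card_coe_set_eq]
  have := Nat.card_congr (degreeLTEquiv K n).toEquiv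
  rw [Nat.card_fun, Nat.card_fin] at this
  exact this

theorem finite_coprimeResidues [Finite K] (h : K[X]) : (coprimeResidues h).Finite :=
  (finite_degreeLT _).subset fun _ hf => hf.1

theorem eq_of_add_mul_eq_add_mul {g f f' r r' : K[X]} (hg : g ≠ 0)
    (hf : f ∈ degreeLT K g.natDegree) (hf' : f' ∈ degreeLT K g.natDegree)
    (h : f + g * r = f' + g * r') : f = f' ∧ r = r' := by
  have hd : f - f' ∈ degreeLT K g.natDegree := Submodule.sub_mem _ hf hf'
  rw [mem_degreeLT, ← degree_eq_natDegree hg] at hd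
  have h0 : f - f' = 0 :=
    eq_zero_of_dvd_of_degree_lt ⟨r' - r, by linear_combination h⟩ hd
  have h1 : f = f' := sub_eq_zero.mp h0
  refine ⟨h1, ?_⟩
  subst h1
  exact mul_left_cancel₀ hg (add_left_cancel h)

/-- Residues modulo `p * g` are written `f + g * r` with `deg f < deg g` and `deg r < deg p`. For
`f` coprime to `g`, at most one `r` makes `p` divide the sum: none if `p ∣ g`, at most one class
modulo `p` otherwise. Repeated factors thus need no separate treatment. -/
theorem sub_one_pow_le_ncard_coprimeResidues [Finite K] {h : K[X]} (h0 : h ≠ 0) :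
    (Nat.card K - 1) ^ h.natDegree ≤ (coprimeResidues h).ncard := by
  classical
  induction h using UniqueFactorizationMonoid.induction_on_prime with
  | h₁ => exact absurd rfl h0
  | h₂ u hu =>
    rw [natDegree_eq_zero_of_isUnit hu, pow_zero, Nat.one_le_iff_ne_zero, ← Nat.pos_iff_ne_zero,
      Set.ncard_pos (finite_coprimeResidues u)]
    exact ⟨0, Submodule.zero_mem _, isCoprime_zero_left.mpr hu⟩
  | h₃ g p hg hp ih =>
    have hp0 := hp.ne_zero
    set A := (finite_coprimeResidues g).toFinset with hA
    set B := (finite_degreeLT (K := K) p.natDegree).toFinset with hB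
    have hBcard : B.card = Nat.card K ^ p.natDegree := by
      rw [← ncard_degreeLT, Set.ncard_eq_toFinset_card _ (finite_degreeLT _)]
    set T : Finset (Σ _ : K[X], K[X]) := A.sigma fun f => B.filter fun r => ¬ p ∣ f + g * r
    have hgood : ∀ f ∈ A, (Nat.card K - 1) ^ p.natDegree ≤
        (B.filter fun r => ¬ p ∣ f + g * r).card := by
      intro f hf
      have hfg : IsCoprime f g := ((finite_coprimeResidues g).mem_toFinset.mp hf).2
      have hbad : (B.filter fun r => p ∣ f + g * r).card ≤ 1 := by
        rw [Finset.card_le_one]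
        intro r hr r' hr'
        rw [Finset.mem_filter] at hr hr'
        have hrd := (finite_degreeLT _).mem_toFinset.mp hr.1
        have hrd' := (finite_degreeLT _).mem_toFinset.mp hr'.1
        have hdvd : p ∣ g * (r - r') := by
          have := dvd_sub hr.2 hr'.2
          rwa [add_sub_add_left_eq_sub, ← mul_sub] at this
        rcases hp.dvd_or_dvd hdvd with h1 | h1
        · have h2 : p ∣ f := (dvd_add_left (h1.mul_right r)).mp hr.2
          exact absurd (hfg.isUnit_of_dvd' h2 h1) hp.not_isUnit
        · have hd : r - r' ∈ degreeLT K p.natDegree := Submodule.sub_mem _ hrd hrd'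
          rw [mem_degreeLT, ← degree_eq_natDegree hp0] at hd
          exact sub_eq_zero.mp (eq_zero_of_dvd_of_degree_lt h1 hd)
      have hsplit := Finset.card_filter_add_card_filter_not (s := B)
        (fun r => p ∣ f + g * r)
      have hs : p.natDegree ≠ 0 := fun h => hp.not_isUnit
        (isUnit_iff_degree_eq_zero.mpr (by rw [degree_eq_natDegree hp0, h]; rfl))
      -- The `+ 1` absorbs the one excluded `r`.
      have hpow : (Nat.card K - 1) ^ p.natDegree + 1 ≤ Nat.card K ^ p.natDegree :=
        Nat.pow_lt_pow_left (Nat.sub_lt Nat.card_pos one_pos) hs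
      omega
    have hT : A.card * (Nat.card K - 1) ^ p.natDegree ≤ T.card := by
      rw [Finset.card_sigma, ← smul_eq_mul]
      exact Finset.card_nsmul_le_sum _ _ _ hgood
    have hTC : T.card ≤ (coprimeResidues (p * g)).ncard := by
      rw [Set.ncard_eq_toFinset_card _ (finite_coprimeResidues _)]
      refine Finset.card_le_card_of_injOn (fun x => x.1 + g * x.2) ?_ ?_
      · rintro ⟨f, r⟩ hx
        simp only [T, Finset.coe_sigma, Set.mem_sigma_iff, Finset.mem_coe, Finset.mem_filter,
          hA, hB, Set.Finite.mem_toFinset] at hx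
        obtain ⟨⟨hf, hfg⟩, hr, hpr⟩ := hx
        simp only [Set.Finite.coe_toFinset]
        refine ⟨?_, ?_⟩
        · rw [natDegree_mul hp0 hg, SetLike.mem_coe.symm.trans Iff.rfl]
          refine Submodule.add_mem _ (degreeLT_mono (Nat.le_add_left _ _) hf) ?_
          have hr' := mem_degreeLT.mp hr
          rw [mem_degreeLT, degree_mul, degree_eq_natDegree hg, add_comm, Nat.cast_add]
          exact WithBot.add_lt_add_right (by simp) hr'
        · refine IsCoprime.mul_right ?_ (hfg.add_mul_left_left r)
          exact ((hp.irreducible.coprime_iff_not_dvd).mpr hpr).symm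
      · rintro ⟨f, r⟩ hx ⟨f', r'⟩ hx' heq
        simp only [T, Finset.coe_sigma, Set.mem_sigma_iff, Finset.mem_coe, Finset.mem_filter,
          hA, hB, Set.Finite.mem_toFinset] at hx hx'
        obtain ⟨h1, h2⟩ := eq_of_add_mul_eq_add_mul hg hx.1.1 hx'.1.1 heq
        subst h1 h2
        rfl
    have hAcard : A.card = (coprimeResidues g).ncard :=
      (Set.ncard_eq_toFinset_card _ (finite_coprimeResidues g)).symm
    rw [natDegree_mul hp0 hg, pow_add, mul_comm]
    refine le_trans (Nat.mul_le_mul_right _ (ih hg)) ?_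
    rw [← hAcard]
    exact hT.trans hTC

end CoprimeCount

/-! ### Conjugate spans as cyclic modules over the Frobenius. -/

section Cyclic

open Polynomial

variable (K : Type*) {L : Type*} [Field K] [Finite K] [Field L] [Algebra K L]

/-- The `q`-power Frobenius of `L` as a `K`-linear endomorphism. -/
noncomputable def frobeniusEnd (L : Type*) [Field L] [Algebra K L] : Module.End K L :=
  letI := Fintype.ofFinite K
  (FiniteField.frobeniusAlgHom K L).toLinearMap

theorem frobeniusEnd_apply (α : L) : frobeniusEnd K L α = α ^ Nat.card K := by
  let := Fintype.ofFinite K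
  rw [Nat.card_eq_fintype_card]
  rfl

theorem frobeniusEnd_pow_apply (i : ℕ) (α : L) :
    (frobeniusEnd K L ^ i) α = α ^ Nat.card K ^ i := by
  induction i with
  | zero => simp
  | succ i ih => rw [pow_succ', Module.End.mul_apply, ih, frobeniusEnd_apply, ← pow_mul, pow_succ]

theorem frobeniusEnd_pow_finrank [FiniteDimensional K L] :
    frobeniusEnd K L ^ Module.finrank K L = 1 := by
  have : Finite L := Module.finite_of_finite K
  ext α
  rw [frobeniusEnd_pow_apply, ← Module.natCard_eq_pow_finrank (K := K) (V := L)]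
  let := Fintype.ofFinite L
  rw [Nat.card_eq_fintype_card, FiniteField.pow_card]
  rfl

/-- The map `f ↦ f(φ) α`, where `φ` is the Frobenius of `L` over `K`. -/
noncomputable def frobeniusEval (α : L) : K[X] →ₗ[K] L :=
  LinearMap.applyₗ α ∘ₗ (aeval (frobeniusEnd K L)).toLinearMap

theorem frobeniusEval_apply (α : L) (f : K[X]) :
    frobeniusEval K α f = aeval (frobeniusEnd K L) f α := rfl

theorem frobeniusEval_mul (α : L) (f g : K[X]) :
    frobeniusEval K α (f * g) = aeval (frobeniusEnd K L) f (frobeniusEval K α g) := by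
  simp [frobeniusEval_apply]

theorem frobeniusEval_frobeniusEval (α : L) (f g : K[X]) :
    frobeniusEval K (frobeniusEval K α g) f = frobeniusEval K α (f * g) := by
  simp [frobeniusEval_apply]

theorem range_frobeniusEval [FiniteDimensional K L] (α : L) :
    LinearMap.range (frobeniusEval K α) = conjugateSpan K α := by
  apply le_antisymm
  · rintro _ ⟨f, rfl⟩
    rw [frobeniusEval_apply, aeval_eq_sum_range, LinearMap.sum_apply]
    refine Submodule.sum_mem _ fun i _ => Submodule.smul_mem _ _ (Submodule.subset_span ?_)
    refine ⟨⟨i % Module.finrank K L, Nat.mod_lt _ Module.finrank_pos⟩, ?_⟩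
    simp only
    rw [← frobeniusEnd_pow_apply]
    conv_rhs => rw [← Nat.mod_add_div i (Module.finrank K L), pow_add, pow_mul,
      frobeniusEnd_pow_finrank, one_pow, mul_one]
  · rw [conjugateSpan, Submodule.span_le]
    rintro _ ⟨i, rfl⟩
    exact ⟨X ^ (i : ℕ), by simp [frobeniusEval_apply, frobeniusEnd_pow_apply]⟩

/-- By Bézout, `f` is invertible modulo `h`, so `α` and `f(φ) α` generate the same cyclic module. -/
theorem conjugateSpan_frobeniusEval [FiniteDimensional K L] {α : L} {f h : K[X]}
    (hh : frobeniusEval K α h = 0) (hf : IsCoprime f h) :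
    conjugateSpan K (frobeniusEval K α f) = conjugateSpan K α := by
  simp only [← range_frobeniusEval]
  apply le_antisymm
  · rintro _ ⟨g, rfl⟩
    exact ⟨g * f, (frobeniusEval_frobeniusEval K α g f).symm⟩
  · rintro _ ⟨g, rfl⟩
    obtain ⟨u, v, huv⟩ := hf
    refine ⟨g * u, ?_⟩
    rw [frobeniusEval_frobeniusEval]
    have : g = g * u * f + g * v * h := by linear_combination -g * huv
    conv_rhs => rw [this, map_add, frobeniusEval_mul K α (g * v) h, hh, map_zero, add_zero]

/-- The polynomials `f` with `f(φ) α = 0`. -/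
noncomputable def frobeniusAnnihilator (α : L) : Ideal K[X] where
  carrier := {f | frobeniusEval K α f = 0}
  add_mem' {f g} hf hg := by
    change frobeniusEval K α (f + g) = 0
    rw [map_add, show frobeniusEval K α f = 0 from hf, show frobeniusEval K α g = 0 from hg,
      add_zero]
  zero_mem' := map_zero _
  smul_mem' c f hf := by
    change frobeniusEval K α (c * f) = 0
    rw [frobeniusEval_mul, show frobeniusEval K α f = 0 from hf, map_zero]

/-- The annihilator is principal and contains `X ^ n - 1`, so its generator `h` is nonzero; the span
of the conjugates is then `K[X] / (h)`. -/
theorem exists_frobeniusEval_eq_zero_iff_dvd [FiniteDimensional K L] (α : L) :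
    ∃ h : K[X], h ≠ 0 ∧ (∀ f, frobeniusEval K α f = 0 ↔ h ∣ f) ∧
      h.natDegree = Module.finrank K (conjugateSpan K α) := by
  set h := Submodule.IsPrincipal.generator (frobeniusAnnihilator K α) with hdef
  have hdvd : ∀ f, frobeniusEval K α f = 0 ↔ h ∣ f := fun f =>
    (Submodule.IsPrincipal.mem_iff_generator_dvd (frobeniusAnnihilator K α) (x := f))
  have h0 : h ≠ 0 := by
    intro h0
    have h1 : frobeniusEval K α (X ^ Module.finrank K L - C 1) = 0 := by
      simp [frobeniusEval_apply, frobeniusEnd_pow_finrank]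
    rw [hdvd, h0, zero_dvd_iff] at h1
    exact X_pow_sub_C_ne_zero Module.finrank_pos 1 h1
  refine ⟨h, h0, hdvd, ?_⟩
  set F := (frobeniusEval K α).domRestrict (degreeLT K h.natDegree) with hF
  have hinj : Function.Injective F := by
    rw [← LinearMap.ker_eq_bot, LinearMap.ker_eq_bot']
    rintro ⟨f, hf⟩ hf0
    rw [mem_degreeLT, ← degree_eq_natDegree h0] at hf
    exact Subtype.ext (eq_zero_of_dvd_of_degree_lt ((hdvd f).mp hf0) hf)
  have hrange : LinearMap.range F = conjugateSpan K α := by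
    rw [← range_frobeniusEval]
    apply le_antisymm
    · rintro _ ⟨f, rfl⟩
      exact ⟨f, rfl⟩
    · rintro _ ⟨f, rfl⟩
      refine ⟨⟨f % h, ?_⟩, ?_⟩
      · rw [mem_degreeLT, ← degree_eq_natDegree h0]
        exact EuclideanDomain.mod_lt f h0
      · change frobeniusEval K α (f % h) = frobeniusEval K α f
        conv_rhs => rw [← EuclideanDomain.mod_add_div f h, map_add,
          (hdvd _).mpr (dvd_mul_right h (f / h)), add_zero]
  rw [← hrange, LinearMap.finrank_range_of_inj hinj, finrank_degreeLT]

theorem sub_one_pow_le_ncard_isKNormal [FiniteDimensional K L] {k : ℕ} {β : L}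
    (hβ : IsKNormal K k β) :
    (Nat.card K - 1) ^ (Module.finrank K L - k) ≤ {α : L | IsKNormal K k α}.ncard := by
  have : Finite L := Module.finite_of_finite K
  obtain ⟨h, h0, hdvd, hdeg⟩ := exists_frobeniusEval_eq_zero_iff_dvd K β
  have hd : Module.finrank K L - k = h.natDegree := by
    unfold IsKNormal at hβ
    omega
  rw [hd]
  refine (sub_one_pow_le_ncard_coprimeResidues h0).trans ?_
  refine Set.ncard_le_ncard_of_injOn (frobeniusEval K β) ?_ ?_ (Set.toFinite _)
  · intro f hf
    change _ + _ = _
    rw [conjugateSpan_frobeniusEval K ((hdvd h).mpr dvd_rfl) hf.2]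
    exact hβ
  · intro f hf g hg hfg
    have h1 : h ∣ f - g := (hdvd _).mp (by rw [map_sub, hfg, sub_self])
    have h2 : f - g ∈ degreeLT K h.natDegree := Submodule.sub_mem _ hf.1 hg.1
    rw [mem_degreeLT, ← degree_eq_natDegree h0] at h2
    exact sub_eq_zero.mp (eq_zero_of_dvd_of_degree_lt h1 h2)

end Cyclic

/-! ### Rankin's bound for the divisor function. -/

section DivisorBound

open Real Finset

theorem log_card_divisors {m : ℕ} (hm : m ≠ 0) :
    log (m.divisors.card : ℝ) = ∑ p ∈ m.primeFactors, log (m.factorization p + 1 : ℝ) := by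
  rw [Nat.card_divisors hm, Nat.cast_prod, log_prod]
  · push_cast; rfl
  · intro p _
    positivity

theorem log_eq_sum_factorization {m : ℕ} (hm : m ≠ 0) :
    log (m : ℝ) = ∑ p ∈ m.primeFactors, m.factorization p * log (p : ℝ) := by
  conv_lhs => rw [← Nat.prod_factorization_pow_eq_self hm]
  rw [Finsupp.prod, Nat.support_factorization, Nat.cast_prod, log_prod]
  · simp
  · intro p hp
    have := (Nat.prime_of_mem_primeFactors hp).pos
    positivity

/-- Rankin-type bound: the logarithm of the number of divisors is at most `δ log m` plus the
sum of the local excesses `log (a + 1) - a δ log p`. -/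
theorem log_card_divisors_le {m : ℕ} (hm : m ≠ 0) (δ : ℝ) (P : Finset ℕ) (g : ℕ → ℝ)
    (hin : ∀ p ∈ P, p.Prime → ∀ a : ℕ, log (a + 1 : ℝ) - a * (δ * log p) ≤ g p)
    (hnonneg : ∀ p ∈ P, 0 ≤ g p)
    (hout : ∀ p ∉ P, p.Prime → ∀ a : ℕ, log (a + 1 : ℝ) - a * (δ * log p) ≤ 0) :
    log (m.divisors.card : ℝ) ≤ ∑ p ∈ P, g p + δ * log m := by
  classical
  rw [log_card_divisors hm, log_eq_sum_factorization hm, mul_sum, ← sub_le_iff_le_add,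
    ← sum_sub_distrib]
  calc ∑ p ∈ m.primeFactors, (log (m.factorization p + 1 : ℝ)
        - δ * (m.factorization p * log (p : ℝ)))
      ≤ ∑ p ∈ m.primeFactors, if p ∈ P then g p else 0 := by
        refine sum_le_sum fun p hp => ?_
        have hpp := Nat.prime_of_mem_primeFactors hp
        split_ifs with h
        · linarith [hin p h hpp (m.factorization p)]
        · linarith [hout p h hpp (m.factorization p)]
    _ = ∑ p ∈ m.primeFactors.filter (· ∈ P), g p := (sum_filter _ _).symm
    _ ≤ ∑ p ∈ P, g p := by
        refine sum_le_sum_of_subset_of_nonneg ?_ fun p hp _ => hnonneg p hp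
        exact fun p hp => (mem_filter.mp hp).2

/-- The ratio of consecutive terms of `(a + 1) ^ D / p ^ a` decreases in `a`, so comparing `a = b -
1` with its two neighbours locates the global maximum. Integer powers keep the hypotheses decidable.
-/
theorem succ_mul_pow_le_pow_mul {D p b : ℕ} (hb : 1 ≤ b) (hup : (b + 1) ^ D ≤ p * b ^ D)
    (hdown : p * (b - 1) ^ D ≤ b ^ D) (a : ℕ) :
    (a + 1) ^ D * p ^ (b - 1) ≤ b ^ D * p ^ a := by
  obtain ⟨c, rfl⟩ : ∃ c, b = c + 1 := ⟨b - 1, by omega⟩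
  simp only [Nat.add_sub_cancel] at *
  rcases le_total c a with h | h
  · induction a, h using Nat.le_induction with
    | base => exact le_rfl
    | succ a hca ih =>
      have h1 : (a + 1 + 1) ^ D * (c + 1) ^ D ≤ (c + 1 + 1) ^ D * (a + 1) ^ D := by
        rw [← mul_pow, ← mul_pow]
        exact Nat.pow_le_pow_left (by nlinarith) D
      have h2 : 0 < (c + 1) ^ D := by positivity
      refine Nat.le_of_mul_le_mul_right ?_ h2
      calc (a + 1 + 1) ^ D * p ^ c * (c + 1) ^ D
          = ((a + 1 + 1) ^ D * (c + 1) ^ D) * p ^ c := by ring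
        _ ≤ ((c + 1 + 1) ^ D * (a + 1) ^ D) * p ^ c := Nat.mul_le_mul_right _ h1
        _ = (c + 1 + 1) ^ D * ((a + 1) ^ D * p ^ c) := by ring
        _ ≤ (p * (c + 1) ^ D) * ((c + 1) ^ D * p ^ a) := Nat.mul_le_mul hup ih
        _ = (c + 1) ^ D * p ^ (a + 1) * (c + 1) ^ D := by ring
  · induction h using Nat.decreasingInduction with
    | self => exact le_rfl
    | of_succ a hac ih =>
      have hc : 0 < c := by omega
      have h1 : (a + 1) ^ D * (c + 1) ^ D ≤ c ^ D * (a + 1 + 1) ^ D := by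
        rw [← mul_pow, ← mul_pow]
        exact Nat.pow_le_pow_left (by nlinarith) D
      rcases Nat.eq_zero_or_pos p with rfl | hp
      · simp [hc.ne']
      have h2 : 0 < (c + 1) ^ D * p := by positivity
      refine Nat.le_of_mul_le_mul_right ?_ h2
      calc (a + 1) ^ D * p ^ c * ((c + 1) ^ D * p)
          = ((a + 1) ^ D * (c + 1) ^ D) * p ^ c * p := by ring
        _ ≤ (c ^ D * (a + 1 + 1) ^ D) * p ^ c * p := by gcongr
        _ = (p * c ^ D) * ((a + 1 + 1) ^ D * p ^ c) := by ring
        _ ≤ (c + 1) ^ D * ((c + 1) ^ D * p ^ (a + 1)) := Nat.mul_le_mul hdown ih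
        _ = (c + 1) ^ D * p ^ a * ((c + 1) ^ D * p) := by ring

/-- The conditions under which `p ^ (b - 1)` maximises `(a + 1) ^ D / p ^ a` among powers of `p`. -/
def IsSuperiorExponent (D p b : ℕ) : Prop :=
  1 ≤ b ∧ (b + 1) ^ D ≤ p * b ^ D ∧ p * (b - 1) ^ D ≤ b ^ D

instance (D p b : ℕ) : Decidable (IsSuperiorExponent D p b) :=
  inferInstanceAs (Decidable (_ ∧ _))

theorem IsSuperiorExponent.log_sub_le {D p b : ℕ} (hD : 0 < D) (hp : 0 < p)
    (h : IsSuperiorExponent D p b) (a : ℕ) :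
    log (a + 1 : ℝ) - a * ((1 / D : ℝ) * log p) ≤ log b - (b - 1 : ℕ) * ((1 / D : ℝ) * log p) := by
  obtain ⟨hb, hup, hdown⟩ := h
  have hnat := succ_mul_pow_le_pow_mul hb hup hdown a
  have hb' : (0 : ℝ) < b := by exact_mod_cast hb
  have hp' : (0 : ℝ) < p := by exact_mod_cast hp
  have hD' : (0 : ℝ) < D := by exact_mod_cast hD
  have hreal : ((a + 1 : ℝ)) ^ D * (p : ℝ) ^ (b - 1) ≤ (b : ℝ) ^ D * (p : ℝ) ^ a := by
    exact_mod_cast hnat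
  have hlog := log_le_log (by positivity) hreal
  rw [log_mul (by positivity) (by positivity), log_mul (by positivity) (by positivity),
    log_pow, log_pow, log_pow, log_pow] at hlog
  refine le_of_mul_le_mul_left ?_ hD'
  field_simp
  linarith

theorem log_card_divisors_le_of_superior {m D : ℕ} (hm : m ≠ 0) (hD : 0 < D) (P : Finset ℕ)
    (b : ℕ → ℕ) (hP : ∀ p < 2 ^ D, p.Prime → p ∈ P) (hP0 : ∀ p ∈ P, 0 < p)
    (hb : ∀ p ∈ P, IsSuperiorExponent D p (b p)) :
    log (m.divisors.card : ℝ) ≤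
      (D * log (∏ p ∈ P, b p : ℕ) - log (∏ p ∈ P, p ^ (b p - 1) : ℕ)) / D + log m / D := by
  have hD' : (0 : ℝ) < D := by exact_mod_cast hD
  have h := log_card_divisors_le hm (1 / D : ℝ) P
    (fun p => log (b p) - (b p - 1 : ℕ) * ((1 / D : ℝ) * log p))
    (fun p hp _ a => (hb p hp).log_sub_le hD (hP0 p hp) a)
    (fun p hp => by simpa using (hb p hp).log_sub_le hD (hP0 p hp) 0) ?_
  · refine h.trans (le_of_eq ?_)
    rw [Nat.cast_prod, Nat.cast_prod, log_prod, log_prod, sum_sub_distrib, sub_div,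
      mul_div_cancel_left₀ _ hD'.ne', sum_div]
    · congr 1
      · congr 1
        refine sum_congr rfl fun p _ => ?_
        rw [Nat.cast_pow, log_pow]
        ring
      · ring
    · intro p hp
      have := hP0 p hp
      positivity
    · intro p hp
      have := (hb p hp).1
      positivity
  · intro p hp hpp a
    have hle : 2 ^ D ≤ p := by
      by_contra hlt
      exact hp (hP p (not_le.mp hlt) hpp)
    -- Once `p ≥ 2 ^ D` the best exponent is `0`, with excess `log 1 = 0`.
    have hs : IsSuperiorExponent D p 1 := ⟨le_rfl, by simpa using hle, by simp [hD.ne']⟩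
    simpa using hs.log_sub_le hD hpp.pos a

/-- An upper bound for the additive constant through an integer power of `2`. -/
theorem log_card_divisors_le_of_pow_le {m D : ℕ} (hm : m ≠ 0) (hD : 0 < D) (P : Finset ℕ)
    (b : ℕ → ℕ) (s t : ℕ) (ht : 0 < t) (hP : ∀ p < 2 ^ D, p.Prime → p ∈ P) (hP0 : ∀ p ∈ P, 0 < p)
    (hb : ∀ p ∈ P, IsSuperiorExponent D p (b p))
    (hst : ((∏ p ∈ P, b p) ^ D) ^ t ≤ 2 ^ s * (∏ p ∈ P, p ^ (b p - 1)) ^ t) :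
    log (m.divisors.card : ℝ) ≤ (s * log 2) / (t * D) + log m / D := by
  refine (log_card_divisors_le_of_superior hm hD P b hP hP0 hb).trans ?_
  have hD' : (0 : ℝ) < D := by exact_mod_cast hD
  have ht' : (0 : ℝ) < t := by exact_mod_cast ht
  set B := ∏ p ∈ P, b p with hB
  set N := ∏ p ∈ P, p ^ (b p - 1) with hN
  have hB0 : (0 : ℝ) < B := by
    exact_mod_cast prod_pos fun p hp => (hb p hp).1
  have hN0 : (0 : ℝ) < N := by
    exact_mod_cast prod_pos fun p hp => pow_pos (hP0 p hp) _
  have hreal : ((B : ℝ) ^ D) ^ t ≤ 2 ^ s * (N : ℝ) ^ t := by exact_mod_cast hst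
  have hlog := log_le_log (by positivity) hreal
  rw [log_mul (by positivity) (by positivity), log_pow, log_pow, log_pow, log_pow] at hlog
  gcongr ?_ + _
  rw [← div_div]
  gcongr
  rw [le_div_iff₀ ht']
  linarith

end DivisorBound

/-! ### The divisor bound for `log m ≤ 1776`. -/

section ExplicitConstants

open Real Finset

/-- Here `b p` is one more than the exponent of `p` in `N = 2520`, which maximises `d(N) ^ 3 / N`;
`11 / 2` bounds the base-2 logarithm of that maximum from above. The next three lemmas follow the
same pattern. -/
theorem log_card_divisors_le_three {m : ℕ} (hm : m ≠ 0) :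
    log (m.divisors.card : ℝ) ≤ (11 * log 2) / (2 * 3) + log m / 3 := by
  have h := log_card_divisors_le_of_pow_le (D := 3) hm (by norm_num) {2, 3, 5, 7}
    (fun p => if p = 2 then 4 else if p = 3 then 3 else 2) 11 2 (by norm_num)
    (by decide +kernel)
    (by decide) (by decide) (by decide +kernel)
  exact_mod_cast h

theorem log_card_divisors_le_four {m : ℕ} (hm : m ≠ 0) :
    log (m.divisors.card : ℝ) ≤ (25 * log 2) / (2 * 4) + log m / 4 := by
  have h := log_card_divisors_le_of_pow_le (D := 4) hm (by norm_num) {2, 3, 5, 7, 11, 13}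
    (fun p => if p = 2 then 6 else if p = 3 then 4 else if p = 5 then 3 else 2) 25 2 (by norm_num)
    (by decide +kernel)
    (by decide) (by decide +kernel) (by decide +kernel)
  exact_mod_cast h

theorem log_card_divisors_le_five {m : ℕ} (hm : m ≠ 0) :
    log (m.divisors.card : ℝ) ≤ (49 * log 2) / (2 * 5) + log m / 5 := by
  have h := log_card_divisors_le_of_pow_le (D := 5) hm (by norm_num)
    {2, 3, 5, 7, 11, 13, 17, 19, 23, 29, 31}
    (fun p => if p = 2 then 7 else if p = 3 then 5 else if p ≤ 7 then 3 else 2) 49 2 (by norm_num)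
    (by decide +kernel)
    (by decide) (by decide +kernel) (by decide +kernel)
  exact_mod_cast h

theorem log_card_divisors_le_seven {m : ℕ} (hm : m ≠ 0) :
    log (m.divisors.card : ℝ) ≤ (74 * log 2) / 7 + log m / 7 := by
  have h := log_card_divisors_le_of_pow_le (D := 7) hm (by norm_num)
    {2, 3, 5, 7, 11, 13, 17, 19, 23, 29, 31, 37, 41, 43, 47, 53, 59, 61, 67, 71, 73, 79, 83, 89,
      97, 101, 103, 107, 109, 113, 127}
    (fun p => if p = 2 then 10 else if p = 3 then 6 else if p ≤ 7 then 4 else if p ≤ 17 then 3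
      else 2) 74 1 (by norm_num)
    (by decide +kernel)
    (by decide) (by decide +kernel) (by decide +kernel)
  rw [Nat.cast_one, one_mul] at h
  exact_mod_cast h

theorem log_le_of_pow_le {c : ℝ} {n k : ℕ} (hc : 0 < c) (hn : 0 < n) (h : c ^ n ≤ 2 ^ k) :
    log c ≤ k / n * log 2 := by
  have h1 := log_le_log (by positivity) h
  rw [log_pow, log_pow] at h1
  have hn' : (0 : ℝ) < n := by exact_mod_cast hn
  rw [div_mul_eq_mul_div, le_div_iff₀ hn']
  linarith

theorem log_le_tangent {x c u : ℝ} (hx : 0 < x) (hc : 0 < c) (hu : log c ≤ u) :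
    log x ≤ u - 1 + x / c := by
  have h := log_le_sub_one_of_pos (div_pos hx hc)
  rw [log_div hx.ne' hc.ne'] at h
  linarith

/-- A linear bound for `log d(m)` beats `1.1 x / log x` on an interval, by concavity of the
quadratic obtained from a tangent to the logarithm. -/
theorem le_mul_div_log_of_endpoints {A s a b c u x : ℝ} {n k : ℕ} (hA : 0 ≤ A) (hs : 0 ≤ s)
    (ha : 1 < x) (hax : a ≤ x) (hxb : x ≤ b) (hab : a < b) (hc : 0 < c) (hn : 0 < n)
    (hck : c ^ n ≤ 2 ^ k) (hu : k / n * 0.69314719 ≤ u)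
    (hqa : (A + s * a) * (u - 1 + a / c) ≤ 1.1 * a)
    (hqb : (A + s * b) * (u - 1 + b / c) ≤ 1.1 * b) :
    A + s * x ≤ 1.1 * x / log x := by
  rw [le_div_iff₀ (log_pos ha)]
  have hlc : log c ≤ u := by
    refine (log_le_of_pow_le hc hn hck).trans (le_trans ?_ hu)
    gcongr
    linarith [log_two_lt_d9]
  have hx0 : 0 < x := by linarith
  have h1 : (A + s * x) * log x ≤ (A + s * x) * (u - 1 + x / c) :=
    mul_le_mul_of_nonneg_left (log_le_tangent hx0 hc hlc) (by positivity)
  refine h1.trans ?_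
  -- With `Q x = (A + s x)(u - 1 + x / c) - 1.1 x`, which is convex, `(b - a) Q x` equals `(b - x) Q
  -- a + (x - a) Q b` minus this term.
  have h2 : 0 ≤ s / c * ((x - a) * (b - x)) * (b - a) := by
    have := mul_nonneg (sub_nonneg.mpr hax) (sub_nonneg.mpr hxb)
    have := (sub_pos.mpr hab).le
    positivity
  have h3 := mul_le_mul_of_nonneg_left hqa (sub_nonneg.mpr hxb)
  have h4 := mul_le_mul_of_nonneg_left hqb (sub_nonneg.mpr hax)
  refine le_of_mul_le_mul_left ?_ (sub_pos.mpr hab)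
  simp only [div_eq_mul_inv] at *
  linarith

theorem log_card_divisors_le_of_log_le {m : ℕ} (hm : 3 ≤ m) (hL : log (m : ℝ) ≤ 1776) :
    log (m.divisors.card : ℝ) ≤ 1.1 * log m / log (log m) := by
  have hm0 : m ≠ 0 := by omega
  have h1 : 1 < log (m : ℝ) := by
    rw [lt_log_iff_exp_lt (by positivity)]
    have : (3 : ℝ) ≤ m := by exact_mod_cast hm
    linarith [exp_one_lt_d9]
  set x := log (m : ℝ) with hx
  have hl2 := log_two_lt_d9
  have h3 : log (m.divisors.card : ℝ) ≤ 1.271 + 1 / 3 * x := by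
    linarith [log_card_divisors_le_three hm0]
  have h4 : log (m.divisors.card : ℝ) ≤ 2.1661 + 1 / 4 * x := by
    linarith [log_card_divisors_le_four hm0]
  have h5 : log (m.divisors.card : ℝ) ≤ 3.3965 + 1 / 5 * x := by
    linarith [log_card_divisors_le_five hm0]
  have h7 : log (m.divisors.card : ℝ) ≤ 7.3276 + 1 / 7 * x := by
    linarith [log_card_divisors_le_seven hm0]
  -- On each interval `c` is the point of tangency, and `u` an upper bound for `log c` certified by
  -- `c ^ n ≤ 2 ^ k`.
  rcases le_total x 6.5 with hb | hb
  · refine h3.trans (le_mul_div_log_of_endpoints (a := 1) (b := 6.5) (c := 4) (u := 1.3863)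
      (n := 1) (k := 2) ?_ ?_ h1 ?_ ?_ ?_ ?_ ?_ ?_ ?_ ?_ ?_) <;> linarith
  rcases le_total x 12 with hb' | hb'
  · refine h3.trans (le_mul_div_log_of_endpoints (a := 6.5) (b := 12) (c := 12) (u := 2.4954)
      (n := 5) (k := 18) ?_ ?_ h1 ?_ ?_ ?_ ?_ ?_ ?_ ?_ ?_ ?_) <;> linarith
  rcases le_total x 22 with hb | hb
  · refine h4.trans (le_mul_div_log_of_endpoints (a := 12) (b := 22) (c := 16) (u := 2.7726)
      (n := 1) (k := 4) ?_ ?_ h1 ?_ ?_ ?_ ?_ ?_ ?_ ?_ ?_ ?_) <;> linarith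
  rcases le_total x 33.5 with hb' | hb'
  · refine h5.trans (le_mul_div_log_of_endpoints (a := 22) (b := 33.5) (c := 21) (u := 3.0499)
      (n := 5) (k := 22) ?_ ?_ h1 ?_ ?_ ?_ ?_ ?_ ?_ ?_ ?_ ?_) <;> linarith
  rcases le_total x 90 with hb | hb
  · refine h5.trans (le_mul_div_log_of_endpoints (a := 33.5) (b := 90) (c := 57) (u := 4.0434)
      (n := 6) (k := 35) ?_ ?_ h1 ?_ ?_ ?_ ?_ ?_ ?_ ?_ ?_ ?_) <;> linarith
  rcases le_total x 611 with hb' | hb'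
  · refine h7.trans (le_mul_div_log_of_endpoints (a := 90) (b := 611) (c := 230) (u := 5.4462)
      (n := 7) (k := 55) ?_ ?_ h1 ?_ ?_ ?_ ?_ ?_ ?_ ?_ ?_ ?_) <;> linarith
  · refine h7.trans (le_mul_div_log_of_endpoints (a := 611) (b := 1776) (c := 1680) (u := 7.4267)
      (n := 7) (k := 75) ?_ ?_ h1 ?_ ?_ ?_ ?_ ?_ ?_ ?_ ?_ ?_) <;> linarith

end ExplicitConstants

/-! ### The divisor bound for `log m ≥ 1776`. -/

section LargeRange

open Real Finset

theorem log_succ_le_mul_log_two (a : ℕ) : log (a + 1 : ℝ) ≤ a * log 2 := by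
  rw [← log_pow]
  refine log_le_log (by positivity) ?_
  exact_mod_cast Nat.lt_two_pow_self (n := a)

/-- The right side is the line in `t` that vanishes at `log 2` and meets `log 3 - 2 t` at `log 2 /
2`. Being linear in `log p` when `t = δ log p`, it can be summed over primes. -/
theorem log_succ_sub_le_of_half_log_two_le {t : ℝ} (h1 : log 2 / 2 ≤ t) (h2 : t ≤ log 2) (a : ℕ) :
    log (a + 1 : ℝ) - a * t ≤ 2 * log (3 / 2) * (1 - t / log 2) := by
  have hl2 : 0 < log 2 := log_pos one_lt_two
  have hl32 : 0 < log (3 / 2 : ℝ) := log_pos (by norm_num)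
  have hnn : 0 ≤ 1 - t / log 2 := by
    rw [sub_nonneg, div_le_one hl2]; exact h2
  have e32 : log (3 / 2 : ℝ) = log 3 - log 2 := log_div (by norm_num) (by norm_num)
  have hkey : log 3 - 2 * t ≤ 2 * log (3 / 2) * (1 - t / log 2) := by
    set z := t / log 2 with hz
    have ht : t = z * log 2 := by rw [hz]; field_simp
    have hz1 : 1 / 2 ≤ z := by rw [hz, le_div_iff₀ hl2]; linarith
    have h34 : log (3 : ℝ) ≤ 2 * log 2 := by
      rw [← log_rpow two_pos]
      exact log_le_log (by norm_num) (by norm_num)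
    rw [e32, ht]
    nlinarith [mul_nonneg (sub_nonneg.mpr h34) (sub_nonneg.mpr hz1)]
  match a with
  | 0 => simpa using mul_nonneg (by positivity) hnn
  | 1 =>
    have h : log 2 * (1 - t / log 2) = log 2 - t := by field_simp
    have h3 : log 2 ≤ 2 * log (3 / 2 : ℝ) := by
      rw [← log_rpow (by norm_num)]
      exact log_le_log (by norm_num) (by norm_num)
    have := mul_le_mul_of_nonneg_right h3 hnn
    norm_num at this ⊢
    linarith
  | (b + 2) =>
    refine le_trans ?_ hkey
    -- Since `(4/3) ^ 2 ≤ 2`, steps beyond `a = 2` gain nothing.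
    have h43 : log (4 / 3 : ℝ) ≤ t := by
      refine le_trans ?_ h1
      rw [le_div_iff₀ two_pos, mul_comm, ← log_rpow (by norm_num)]
      exact log_le_log (by norm_num) (by norm_num)
    have hb : log ((b : ℝ) + 3) ≤ log 3 + b * log (4 / 3) := by
      rw [← log_pow, ← log_mul (by norm_num) (by positivity)]
      refine log_le_log (by positivity) ?_
      have := one_add_mul_le_pow (a := (1 / 3 : ℝ)) (by norm_num) b
      norm_num at this ⊢
      linarith
    have hb2 := mul_le_mul_of_nonneg_left h43 (Nat.cast_nonneg (α := ℝ) b)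
    push_cast
    rw [show (b : ℝ) + 2 + 1 = b + 3 by ring]
    linarith

/-- This is the maximum over real `a`, attained at `a + 1 = 1 / t`; it serves the small primes. -/
theorem log_succ_sub_le_sub_log {t : ℝ} (ht : 0 < t) (a : ℕ) :
    log (a + 1 : ℝ) - a * t ≤ t - 1 - log t := by
  have h := log_le_sub_one_of_pos (mul_pos (Nat.cast_add_one_pos (α := ℝ) a) ht)
  rw [log_mul (Nat.cast_add_one_ne_zero a) ht.ne'] at h
  linarith

theorem neg_log_log_two_le : -log (log 2) ≤ 0.367 := by
  have h1 := log_two_gt_d9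
  have h2 := log_two_lt_d9
  have hl : (0 : ℝ) < log 2 := by linarith
  -- `2 (log 2) ^ 2` is about `0.96`, close enough to `1` for `log z ≤ z - 1` to be sharp.
  have h := log_le_sub_one_of_pos (show (0 : ℝ) < 1 / (2 * (log 2 * log 2)) by positivity)
  rw [log_div one_ne_zero (by positivity), log_mul two_ne_zero (by positivity),
    log_mul hl.ne' hl.ne', log_one] at h
  have h3 : 1 / (2 * (log 2 * log 2)) ≤ 1.0407 := by
    rw [div_le_iff₀ (by positivity)]
    nlinarith
  linarith

theorem sum_two_mul_odd_le {f : ℕ → ℝ} (k : ℕ)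
    (hf : ∀ n, 1 ≤ n → n ≤ 2 * k → f (n + 1) ≤ f n) :
    2 * ∑ j ∈ Icc 1 k, f (2 * j + 1) ≤ ∑ n ∈ Icc 2 (2 * k + 1), f n := by
  induction k with
  | zero => simp
  | succ k ih =>
    rw [sum_Icc_succ_top (by omega), show 2 * (k + 1) + 1 = 2 * k + 1 + 1 + 1 by ring,
      sum_Icc_succ_top (by omega), sum_Icc_succ_top (by omega)]
    have h1 := ih fun n h1 h2 => hf n h1 (by omega)
    have h2 := hf (2 * k + 1 + 1) (by omega) (by omega)
    linarith

/-- Every prime other than `2` is odd, and each odd term is at most the preceding even one. -/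
theorem sum_primes_le_of_antitone {f : ℕ → ℝ} {N : ℕ} (hN : 2 ≤ N)
    (hf : ∀ n, 1 ≤ n → n < N → f (n + 1) ≤ f n) (h0 : ∀ n ≤ N, 1 ≤ n → 0 ≤ f n) :
    ∑ p ∈ (range (N + 1)).filter Nat.Prime, f p ≤ f 2 + (∑ n ∈ Icc 2 N, f n) / 2 := by
  classical
  set k := (N - 1) / 2 with hk
  have hodd : ∑ j ∈ Icc 1 k, f (2 * j + 1) ≤ (∑ n ∈ Icc 2 N, f n) / 2 := by
    have h1 := sum_two_mul_odd_le (f := f) k fun n h1 h2 => hf n h1 (by omega)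
    have h2 : ∑ n ∈ Icc 2 (2 * k + 1), f n ≤ ∑ n ∈ Icc 2 N, f n := by
      refine sum_le_sum_of_subset_of_nonneg (Icc_subset_Icc le_rfl (by omega)) fun n hn _ => ?_
      rw [mem_Icc] at hn
      exact h0 n hn.2 (by omega)
    linarith
  have hsub : (range (N + 1)).filter Nat.Prime ⊆
      insert 2 ((Icc 1 k).image fun j => 2 * j + 1) := by
    intro p hp
    rw [mem_filter, mem_range] at hp
    rw [mem_insert, mem_image]
    rcases hp.2.eq_two_or_odd with h | h
    · exact Or.inl h
    · have := hp.2.two_le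
      exact Or.inr ⟨(p - 1) / 2, by rw [mem_Icc]; omega, by omega⟩
  have hmem : ∀ n ∈ insert 2 ((Icc 1 k).image fun j => 2 * j + 1), 1 ≤ n ∧ n ≤ N := by
    intro n hn
    rw [mem_insert, mem_image] at hn
    rcases hn with rfl | ⟨j, hj, rfl⟩
    · omega
    · rw [mem_Icc] at hj
      omega
  refine (sum_le_sum_of_subset_of_nonneg hsub fun n hn _ => h0 n (hmem n hn).2 (hmem n hn).1).trans
    ?_
  rw [sum_insert, sum_image]
  · linarith
  · intro i _ j _ hij
    simp only at hij
    omega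
  · rw [mem_image]
    rintro ⟨j, _, hj⟩
    omega

/-- With `N = ⌊y⌋₊` the sum is `log (y ^ N / N!)`, and `y ^ N / N!` is a single term of the series
of `exp y`. -/
theorem sum_log_sub_log_le {y : ℝ} (hy : 1 ≤ y) :
    ∑ n ∈ Icc 1 ⌊y⌋₊, (log y - log n) ≤ y := by
  have hy0 : 0 < y := by linarith
  have h := pow_div_factorial_le_exp y hy0.le ⌊y⌋₊
  have h1 := log_le_log (by positivity) h
  rw [log_exp, log_div (by positivity) (by positivity), log_pow] at h1
  rw [sum_sub_distrib, sum_const, Nat.card_Icc, Nat.add_sub_cancel, nsmul_eq_mul, ← log_prod]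
  · have h2 : ∀ N : ℕ, ∏ n ∈ Icc 1 N, (n : ℝ) = (N.factorial : ℝ) := by
      intro N
      induction N with
      | zero => simp
      | succ N ih =>
        rw [prod_Icc_succ_top (by omega), ih, Nat.factorial_succ, Nat.cast_mul, mul_comm]
    rwa [h2]
  · intro n hn
    rw [mem_Icc] at hn
    exact_mod_cast (show n ≠ 0 by omega)

theorem sum_primes_log_sub_log_le {y : ℝ} (hy : 2 ≤ y) :
    ∑ p ∈ (range (⌊y⌋₊ + 1)).filter Nat.Prime, (log y - log p) ≤ (log y + y) / 2 := by
  have hN : 2 ≤ ⌊y⌋₊ := Nat.le_floor (by exact_mod_cast hy)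
  have hy0 : 0 < y := by linarith
  have h := sum_primes_le_of_antitone (f := fun n => log y - log n) hN
    (fun n h1 _ => by
      have : (0 : ℝ) < n := by exact_mod_cast h1
      have := log_le_log this (show (n : ℝ) ≤ (n + 1 : ℕ) by push_cast; linarith)
      linarith)
    (fun n h1 h2 => by
      have : (0 : ℝ) < n := by exact_mod_cast h2
      have := log_le_log this ((Nat.cast_le.mpr h1).trans (Nat.floor_le hy0.le))
      linarith)
  have h1 := sum_log_sub_log_le (show 1 ≤ y by linarith)
  rw [← add_sum_Ioc_eq_sum_Icc (by omega)] at h1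
  have h2 : Ioc 1 ⌊y⌋₊ = Icc 2 ⌊y⌋₊ := by
    ext n; simp only [mem_Ioc, mem_Icc]; omega
  rw [h2] at h1
  have := log_pos one_lt_two
  norm_num at h h1
  norm_num
  linarith

theorem card_primes_sq_lt_le (y : ℝ) (N : ℕ) :
    ((((range N).filter Nat.Prime).filter fun p : ℕ => (p : ℝ) ^ 2 < y).card : ℝ) ≤ √y / 2 + 1 := by
  have h : (((range N).filter Nat.Prime).filter fun p : ℕ => (p : ℝ) ^ 2 < y).card ≤
      (range (⌊√y⌋₊ / 2 + 1)).card := by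
    -- This sends `2` to `0` and the odd primes injectively to positive integers.
    refine card_le_card_of_injOn (fun p => (p - 1) / 2) ?_ ?_
    · intro p hp
      simp only [coe_filter, mem_filter, mem_range, Set.mem_ofPred_eq] at hp
      have : p ≤ ⌊√y⌋₊ := Nat.le_floor (Real.le_sqrt_of_sq_le hp.2.le)
      simp only [coe_range, Set.mem_Iio]
      omega
    · intro p hp r hr hpr
      simp only [coe_filter, mem_filter, mem_range, Set.mem_ofPred_eq] at hp hr hpr
      have h1 := hp.1.2.two_le
      have h2 := hr.1.2.two_le
      rcases hp.1.2.eq_two_or_odd with h3 | h3 <;> rcases hr.1.2.eq_two_or_odd with h4 | h4 <;>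
        omega
  rw [card_range] at h
  have h1 : (⌊√y⌋₊ / 2 : ℕ) ≤ √y / 2 :=
    Nat.cast_div_le.trans (div_le_div_of_nonneg_right (Nat.floor_le (sqrt_nonneg y)) two_pos.le)
  have h2 : ((((range N).filter Nat.Prime).filter fun p : ℕ => (p : ℝ) ^ 2 < y).card : ℝ) ≤
      (⌊√y⌋₊ / 2 + 1 : ℕ) := by exact_mod_cast h
  push_cast at h2
  linarith

/-- With `y = 2 ^ D`, primes above `y` contribute nothing, those in `[√y, y]` obey the linear bound,
and those below `√y` are few, each costing at most `log D - 0.28`. -/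
theorem log_card_divisors_le_of_real {m : ℕ} (hm : m ≠ 0) {D y : ℝ} (hD : 2 ≤ D)
    (hy : log y = D * log 2) (hy2 : 2 ≤ y) :
    log (m.divisors.card : ℝ) ≤ (√y / 2 + 1) * (log D - 0.28) +
      log (3 / 2) * (1 + y / log y) + log m / D := by
  have hl2 : 0 < log 2 := log_pos one_lt_two
  have hl2' := log_two_lt_d9
  have hl2g := log_two_gt_d9
  have hD0 : 0 < D := by linarith
  have hy0 : 0 < y := by linarith
  have hly : 0 < log y := by rw [hy]; positivity
  have hl32 : 0 < log (3 / 2 : ℝ) := log_pos (by norm_num)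
  have hlogD : 0 ≤ log D - 0.28 := by
    have := log_le_log two_pos hD
    linarith
  set P := (range (⌊y⌋₊ + 1)).filter Nat.Prime with hP
  have hPprime : ∀ p ∈ P, p.Prime := fun p hp => (mem_filter.mp hp).2
  have hPle : ∀ p ∈ P, log (p : ℝ) ≤ log y := by
    intro p hp
    have h1 : p ≤ ⌊y⌋₊ := Nat.lt_succ_iff.mp (mem_range.mp (mem_filter.mp hp).1)
    have h2 : (0 : ℝ) < p := by exact_mod_cast (hPprime p hp).pos
    exact log_le_log h2 ((Nat.cast_le.mpr h1).trans (Nat.floor_le hy0.le))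
  have htdiv : ∀ p : ℕ, 1 / D * log p / log 2 = log p / log y := by
    intro p; rw [hy]; field_simp
  have hlin : ∀ p ∈ P, 0 ≤ 2 * log (3 / 2) * (1 - log p / log y) := by
    intro p hp
    have : log p / log y ≤ 1 := (div_le_one hly).mpr (hPle p hp)
    have : 0 ≤ 1 - log p / log y := by linarith
    positivity
  set g : ℕ → ℝ := fun p => if (p : ℝ) ^ 2 < y then log D - 0.28 else
    2 * log (3 / 2) * (1 - log p / log y) with hg
  have hmain := log_card_divisors_le hm (1 / D) P g ?_ ?_ ?_
  · have hsum : ∑ p ∈ P, g p ≤ (√y / 2 + 1) * (log D - 0.28) + log (3 / 2) * (1 + y / log y) := by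
      have h1 : ∑ p ∈ P, g p ≤ ∑ p ∈ P, ((if (p : ℝ) ^ 2 < y then log D - 0.28 else 0) +
          2 * log (3 / 2) * (1 - log p / log y)) := by
        refine sum_le_sum fun p hp => ?_
        have := hlin p hp
        simp only [hg]
        split_ifs <;> linarith
      refine h1.trans ?_
      rw [sum_add_distrib]
      refine add_le_add ?_ ?_
      · rw [← sum_filter, sum_const, nsmul_eq_mul]
        exact mul_le_mul_of_nonneg_right (card_primes_sq_lt_le y _) hlogD
      · have h2 : ∀ p ∈ P, 2 * log (3 / 2) * (1 - log p / log y) =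
            2 * log (3 / 2) / log y * (log y - log p) := by
          intro p _; field_simp
        rw [sum_congr rfl h2, ← mul_sum]
        refine (mul_le_mul_of_nonneg_left (sum_primes_log_sub_log_le hy2)
          (by positivity)).trans (le_of_eq ?_)
        field_simp
    have : 1 / D * log m = log m / D := by ring
    linarith
  · intro p hp hpp a
    have hp2 : log 2 ≤ log p := log_le_log two_pos (by exact_mod_cast hpp.two_le)
    simp only [hg]
    have hp0 : (0 : ℝ) < p := by exact_mod_cast hpp.pos
    split_ifs with hlt
    · have hlp : 0 < log (p : ℝ) := hl2.trans_le hp2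
      have ht : 0 < 1 / D * log p := by positivity
      refine (log_succ_sub_le_sub_log ht a).trans ?_
      have h1 := log_le_log (by positivity) hlt.le
      rw [log_pow, hy] at h1
      have h2 : 1 / D * log p ≤ log 2 / 2 := by
        rw [one_div_mul_eq_div, div_le_iff₀ hD0]
        push_cast at h1
        linarith
      have h3 : log (1 / D * log p) = - log D + log (log p) := by
        rw [log_mul (by positivity) (by linarith), log_div one_ne_zero hD0.ne', log_one, zero_sub]
      have h4 : log (log 2) ≤ log (log p) := log_le_log hl2 hp2
      rw [h3]
      -- The constant comes from `log 2 / 2 - 1 + 0.367 < -0.28`.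
      linarith [neg_log_log_two_le]
    · rw [← htdiv]
      refine log_succ_sub_le_of_half_log_two_le ?_ ?_ a
      · have h1 := log_le_log hy0 (not_lt.mp hlt)
        rw [log_pow, hy] at h1
        rw [one_div_mul_eq_div, le_div_iff₀ hD0]
        push_cast at h1
        linarith
      · rw [one_div_mul_eq_div, div_le_iff₀ hD0]
        linarith [hPle p hp]
  · intro p hp
    have := hlin p hp
    simp only [hg]
    split_ifs <;> linarith
  · intro p hp hpp a
    have hlt : y < p := by
      rw [← Nat.floor_lt hy0.le]
      by_contra hle
      exact hp (mem_filter.mpr ⟨mem_range.mpr (by omega), hpp⟩)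
    have h1 := log_le_log hy0 hlt.le
    have h2 : log 2 ≤ 1 / D * log p := by
      rw [one_div_mul_eq_div, le_div_iff₀ hD0]
      linarith
    have := mul_le_mul_of_nonneg_left h2 (Nat.cast_nonneg (α := ℝ) a)
    linarith [log_succ_le_mul_log_two a]

theorem log_card_divisors_le_of_le_log {m : ℕ} (hL : 1776 ≤ log (m : ℝ)) :
    log (m.divisors.card : ℝ) ≤ 1.1 * log m / log (log m) := by
  have hm : m ≠ 0 := by
    rintro rfl
    norm_num at hL
  have hl2 := log_two_lt_d9
  have hl2' := log_two_gt_d9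
  set L := log (m : ℝ) with hLdef
  have hL0 : 0 < L := by linarith
  set u := log L with hu
  have hLu : L = exp u := (exp_log hL0).symm
  have hu7 : 7.45 ≤ u := by
    have h1 : log ((2 : ℝ) ^ 43) ≤ log (L ^ 4) := by
      refine log_le_log (by positivity) (le_trans ?_ (pow_le_pow_left₀ (by norm_num) hL 4))
      norm_num
    rw [log_pow, log_pow] at h1
    push_cast at h1
    linarith
  set D := u + 1 with hD
  set y := exp (D * log 2) with hy
  have hly : log y = D * log 2 := log_exp _
  have hsq : √y = exp (D * log 2 / 2) := by
    rw [hy, ← exp_half]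
  have hy2 : 2 ≤ y := by
    rw [← exp_log (two_pos : (0 : ℝ) < 2), hy]
    exact exp_le_exp.mpr (by nlinarith)
  have hmain := log_card_divisors_le_of_real hm (by linarith : 2 ≤ D) hly hy2
  -- Normalised to be at least `1`, so that factors polynomial in `u` become powers of `ρ`. In `h1`,
  -- `h2`, `h3` the exponents are linear in `u` with slope below `1`, which reduces them to `u =
  -- 7.45`.
  set ρ := u / 7.45 with hρ
  have hu_eq : u = 7.45 * ρ := by rw [hρ]; ring
  have hρ1 : 1 ≤ ρ := by rw [hρ, le_div_iff₀ (by norm_num)]; linarith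
  have hρe : ρ ≤ exp (0.2 * (u - 7.45)) := by
    have := add_one_le_exp (0.2 * (u - 7.45))
    linarith
  have hρ3 : ρ ^ 3 ≤ exp (0.6 * (u - 7.45)) := by
    refine (pow_le_pow_left₀ (by linarith) hρe 3).trans (le_of_eq ?_)
    rw [← exp_nat_mul]
    congr 1
    push_cast
    ring
  have hexp : ∀ {c : ℝ} {n k : ℕ}, 0 < c → 0 < n → c ^ n ≤ 2 ^ k → c ≤ exp (k / n * log 2) := by
    intro c n k hc hn h
    rw [← log_le_iff_le_exp hc]
    exact log_le_of_pow_le hc hn h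
  have h1 : y * ρ * (1000 / 206) ≤ L := by
    have hc : (1000 / 206 : ℝ) ≤ exp ((16 : ℕ) / (7 : ℕ) * log 2) :=
      hexp (by norm_num) (by norm_num) (by norm_num)
    calc y * ρ * (1000 / 206) ≤ exp (D * log 2) * exp (0.2 * (u - 7.45)) *
          exp ((16 : ℕ) / (7 : ℕ) * log 2) := by gcongr
      _ ≤ L := by
        rw [← exp_add, ← exp_add, hLu, exp_le_exp]
        push_cast
        nlinarith
  have h2 : √y * ρ ^ 3 * (10000 / 112) ≤ L := by
    have hc : (10000 / 112 : ℝ) ≤ exp ((13 : ℕ) / (2 : ℕ) * log 2) :=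
      hexp (by norm_num) (by norm_num) (by norm_num)
    calc √y * ρ ^ 3 * (10000 / 112) ≤ exp (D * log 2 / 2) * exp (0.6 * (u - 7.45)) *
          exp ((13 : ℕ) / (2 : ℕ) * log 2) := by rw [hsq]; gcongr
      _ ≤ L := by
        rw [← exp_add, ← exp_add, hLu, exp_le_exp]
        push_cast
        nlinarith
  have h3 : ρ ^ 3 * 1562.5 ≤ L := by
    have hc : (1562.5 : ℝ) ≤ exp ((32 : ℕ) / (3 : ℕ) * log 2) :=
      hexp (by norm_num) (by norm_num) (by norm_num)
    calc ρ ^ 3 * 1562.5 ≤ exp (0.6 * (u - 7.45)) * exp ((32 : ℕ) / (3 : ℕ) * log 2) := by gcongr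
      _ ≤ L := by
        rw [← exp_add, hLu, exp_le_exp]
        push_cast
        nlinarith
  have hu0 : 0 < u := by linarith
  have hD0 : 0 < D := by linarith
  have hDρ : D ≤ 8.45 * ρ := by linarith
  have hlogD : log D - 0.28 ≤ 1.856 * ρ := by
    have h8 : log (8 : ℝ) ≤ 3 * log 2 := by
      rw [show (8 : ℝ) = 2 ^ 3 by norm_num, log_pow]
      push_cast
      exact le_rfl
    have := log_le_tangent hD0 (by norm_num) h8
    linarith
  have hl32 : log (3 / 2 : ℝ) ≤ 0.408 := by
    have := log_le_of_pow_le (c := 3 / 2) (n := 17) (k := 10) (by norm_num) (by norm_num)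
      (by norm_num)
    push_cast at this
    linarith
  have hsy : 0 ≤ √y := sqrt_nonneg y
  have hy0 : 0 < y := by linarith
  have hρ0 : 0 < ρ := by linarith
  have hly0 : 0 < log y := by rw [hly]; nlinarith
  have hA : (√y / 2 + 1) * (log D - 0.28) + log (3 / 2) * (1 + y / log y) ≤
      (√y / 2 + 1) * (1.856 * ρ) + 0.408 * (1 + y / log y) := by gcongr
  have hDA : D * ((√y / 2 + 1) * (log D - 0.28) + log (3 / 2) * (1 + y / log y)) * ρ ≤
      0.24 * L := by
    have e1 : D * (y / log y) ≤ 1.4428 * y := by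
      rw [hly, show D * (y / (D * log 2)) = y / log 2 by field_simp, div_le_iff₀ (by linarith)]
      nlinarith
    have e2 : D * ((√y / 2 + 1) * (1.856 * ρ)) ≤ 8.45 * ρ * ((√y / 2 + 1) * (1.856 * ρ)) := by
      gcongr
    have e3 : D * ((√y / 2 + 1) * (log D - 0.28) + log (3 / 2) * (1 + y / log y)) ≤
        15.69 * (√y / 2 + 1) * ρ ^ 2 + 3.45 * ρ + 0.589 * y := by
      have e4 := mul_le_mul_of_nonneg_left hA hD0.le
      have e5 : 0 ≤ (√y / 2 + 1) * ρ ^ 2 := by positivity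
      have e6 : D * ((√y / 2 + 1) * (1.856 * ρ) + 0.408 * (1 + y / log y)) =
          D * ((√y / 2 + 1) * (1.856 * ρ)) + 0.408 * D + 0.408 * (D * (y / log y)) := by ring
      have e7 : 8.45 * ρ * ((√y / 2 + 1) * (1.856 * ρ)) =
          15.6832 * ((√y / 2 + 1) * ρ ^ 2) := by ring
      have e8 : 15.69 * (√y / 2 + 1) * ρ ^ 2 = 15.69 * ((√y / 2 + 1) * ρ ^ 2) := by ring
      rw [e8]
      linarith
    have e4 := mul_le_mul_of_nonneg_right e3 hρ0.le
    have e5 : ρ ^ 2 ≤ ρ ^ 3 := pow_le_pow_right₀ hρ1 (by norm_num)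
    refine e4.trans ?_
    have e6 : (15.69 * (√y / 2 + 1) * ρ ^ 2 + 3.45 * ρ + 0.589 * y) * ρ =
        7.845 * (√y * ρ ^ 3) + 15.69 * ρ ^ 3 + 3.45 * ρ ^ 2 + 0.589 * (y * ρ) := by ring
    rw [e6]
    linarith
  have hfin : ((√y / 2 + 1) * (log D - 0.28) + log (3 / 2) * (1 + y / log y)) ≤
      1.1 * L / u - L / D := by
    refine le_of_mul_le_mul_left ?_ (mul_pos hD0 hρ0)
    -- As `ρ ≥ 1`, the right side is at least `0.247 L`, against the `0.24 L` of `hDA`.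
    have e : D * ρ * (1.1 * L / u - L / D) = L * (0.1 * ρ + 1.1 / 7.45) := by
      rw [hD, hρ]
      field_simp
      ring
    have hLρ : L * 1 ≤ L * ρ := mul_le_mul_of_nonneg_left hρ1 hL0.le
    rw [e, mul_right_comm]
    linarith
  linarith

/-- The divisor bound `d(m) ≤ m ^ (1.1 / log log m)` for `m ≥ 3`, in logarithmic form. -/
theorem log_card_divisors_le_div_log_log {m : ℕ} (hm : 3 ≤ m) :
    log (m.divisors.card : ℝ) ≤ 1.1 * log m / log (log m) := by
  rcases le_total (log (m : ℝ)) 1776 with h | h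
  · exact log_card_divisors_le_of_log_le hm h
  · exact log_card_divisors_le_of_le_log h

end LargeRange

/-! ### Counting by order, and the conclusion. -/

section Counting

open Finset

/-- A cyclic group has at most `e` elements of order `e`, and every order divides the group order.
-/
theorem IsCyclic.card_lt_mul_card_divisors {G : Type*} [Group G] [IsCyclic G] [Finite G]
    {S : Finset G} (hS : S.Nonempty) {T : ℝ} (hT : ∀ a ∈ S, (orderOf a : ℝ) < T) :
    (S.card : ℝ) < T * (Nat.card G).divisors.card := by
  classical
  let := Fintype.ofFinite G
  set E := (Nat.card G).divisors.filter fun e : ℕ => (e : ℝ) < T with hE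
  have hmem : ∀ a ∈ S, orderOf a ∈ E := fun a ha =>
    mem_filter.mpr ⟨Nat.mem_divisors.mpr ⟨orderOf_dvd_natCard a, Nat.card_pos.ne'⟩, hT a ha⟩
  have h1 : S.card ≤ ∑ e ∈ E, e := by
    rw [card_eq_sum_card_fiberwise (f := orderOf) (t := E) hmem]
    refine sum_le_sum fun e he => ?_
    have he0 : 0 < e := Nat.pos_of_mem_divisors (mem_filter.mp he).1
    refine le_trans (card_le_card fun a ha => ?_) (IsCyclic.card_pow_eq_one_le (α := G) he0)
    rw [mem_filter] at ha ⊢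
    exact ⟨mem_univ a, ha.2 ▸ pow_orderOf_eq_one a⟩
  obtain ⟨a, ha⟩ := hS
  have h2 : ∑ e ∈ E, (e : ℝ) < ∑ _e ∈ E, T :=
    sum_lt_sum_of_nonempty ⟨_, hmem a ha⟩ fun e he => (mem_filter.mp he).2
  rw [sum_const, nsmul_eq_mul, mul_comm] at h2
  have hT0 : 0 ≤ T := (Nat.cast_nonneg _).trans (hT a ha).le
  have h3 : (E.card : ℝ) ≤ (Nat.card G).divisors.card := by
    exact_mod_cast card_filter_le _ _
  calc (S.card : ℝ) ≤ ∑ e ∈ E, (e : ℝ) := (Nat.cast_le.mpr h1).trans_eq (Nat.cast_sum _ _)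
    _ < T * E.card := h2
    _ ≤ T * (Nat.card G).divisors.card := by gcongr

/-- Bernoulli with exponent `q / 2 ≥ 1` gives `(1 - 1/q) ^ (q/2) ≥ 1/2`. -/
theorem four_rpow_mul_le_sub_one {q : ℝ} (hq : 2 ≤ q) : (4 : ℝ) ^ (-1 / q) * q ≤ q - 1 := by
  have hq0 : 0 < q := by linarith
  have hs : (-1 : ℝ) ≤ -1 / q := by
    rw [le_div_iff₀ hq0]
    linarith
  have h := one_add_mul_self_le_rpow_one_add hs (show 1 ≤ q / 2 by linarith)
  have h1 : 1 + q / 2 * (-1 / q) = 1 / 2 := by field_simp; norm_num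
  rw [h1] at h
  have h2 : (0 : ℝ) ≤ 1 + -1 / q := by linarith
  have h3 := Real.rpow_le_rpow (by norm_num) h (show 0 ≤ 2 / q by positivity)
  rw [← Real.rpow_mul h2, show q / 2 * (2 / q) = 1 by field_simp, Real.rpow_one] at h3
  have h4 : (4 : ℝ) ^ (-1 / q) = (1 / 2 : ℝ) ^ (2 / q) := by
    rw [show (4 : ℝ) = (1 / 2 : ℝ) ^ (-2 : ℝ) by norm_num [Real.rpow_neg],
      ← Real.rpow_mul (by norm_num)]
    congr 1
    ring
  rw [h4]
  calc (1 / 2 : ℝ) ^ (2 / q) * q ≤ (1 + -1 / q) * q := by gcongr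
    _ = q - 1 := by field_simp; ring

theorem kNormalOrderBound_mul_card_divisors_le {k q n : ℕ} (hq : 2 ≤ q) (hn : 2 ≤ n)
    (hk : k ≤ n) :
    kNormalOrderBound k q n * ((q ^ n - 1).divisors.card : ℝ) ≤ ((q - 1) ^ (n - k) : ℕ) := by
  have hpow : 4 ≤ q ^ n :=
    (Nat.pow_le_pow_left hq 2).trans (Nat.pow_le_pow_right (by omega) hn)
  have hm : 3 ≤ q ^ n - 1 := by omega
  have hqr : (2 : ℝ) ≤ q := by exact_mod_cast hq
  have hq0 : (0 : ℝ) < q := by linarith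
  set m := q ^ n - 1 with hmdef
  have hmr : (m : ℝ) = (q : ℝ) ^ n - 1 := by
    rw [hmdef, Nat.cast_sub (by omega), Nat.cast_pow, Nat.cast_one]
  have hm3 : (3 : ℝ) ≤ m := by exact_mod_cast hm
  have hlm : 1 < Real.log m := by
    rw [Real.lt_log_iff_exp_lt (by linarith)]
    linarith [Real.exp_one_lt_d9]
  have hll : 0 < Real.log (Real.log m) := Real.log_pos hlm
  have hd0 : 0 < (m.divisors.card : ℝ) := by
    exact_mod_cast Finset.card_pos.mpr (Nat.nonempty_divisors.mpr (by omega))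
  have hd : (m.divisors.card : ℝ) ≤ (q : ℝ) ^ (1.1 * (n : ℝ) / Real.log (Real.log m)) := by
    rw [← Real.log_le_log_iff hd0 (by positivity), Real.log_rpow hq0]
    refine (log_card_divisors_le_div_log_log hm).trans ?_
    have h1 : Real.log m ≤ n * Real.log q := by
      rw [← Real.log_pow]
      exact Real.log_le_log (by linarith) (by rw [hmr]; linarith)
    rw [div_mul_eq_mul_div, mul_assoc]
    gcongr
  rw [kNormalOrderBound, ← hmr]
  have hsplit : (q : ℝ) ^ ((n : ℝ) - k - 1.1 * n / Real.log (Real.log m)) *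
      (q : ℝ) ^ (1.1 * (n : ℝ) / Real.log (Real.log m)) = (q : ℝ) ^ (n - k) := by
    rw [← Real.rpow_add hq0, sub_add_cancel, ← Nat.cast_sub hk, Real.rpow_natCast]
  have h4 : (4 : ℝ) ^ (((k : ℝ) - n) / q) = ((4 : ℝ) ^ (-1 / (q : ℝ))) ^ (n - k) := by
    rw [← Real.rpow_natCast, ← Real.rpow_mul (by norm_num), Nat.cast_sub hk]
    congr 1
    ring
  calc _ ≤ (4 : ℝ) ^ (((k : ℝ) - n) / q) *
        (q : ℝ) ^ ((n : ℝ) - k - 1.1 * n / Real.log (Real.log m)) *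
        (q : ℝ) ^ (1.1 * (n : ℝ) / Real.log (Real.log m)) := by gcongr
    _ = ((4 : ℝ) ^ (-1 / (q : ℝ)) * q) ^ (n - k) := by rw [mul_assoc, hsplit, h4, mul_pow]
    _ ≤ ((q : ℝ) - 1) ^ (n - k) :=
        pow_le_pow_left₀ (by positivity) (four_rpow_mul_le_sub_one hqr) _
    _ = ((q - 1) ^ (n - k) : ℕ) := by
        rw [Nat.cast_pow, Nat.cast_sub (by omega), Nat.cast_one]

theorem IsKNormal.ne_zero {K L : Type*} [Field K] [Finite K] [Field L] [Algebra K L] {k : ℕ}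
    {α : L} (hk : k < Module.finrank K L) (h : IsKNormal K k α) : α ≠ 0 := by
  rintro rfl
  have hbot : conjugateSpan K (0 : L) = ⊥ := by
    rw [conjugateSpan, Submodule.span_eq_bot]
    rintro _ ⟨i, rfl⟩
    exact zero_pow (pow_ne_zero _ Nat.card_pos.ne')
  rw [IsKNormal, hbot, finrank_bot] at h
  omega

end Counting

theorem mainTheorem2 {K L : Type*} [Field K] [Finite K] [Field L] [Algebra K L]
    (k q n : ℕ) (hq : Nat.card K = q) (hL : Module.finrank K L = n)
    (hn : 2 ≤ n) (hk : k ≤ n - 1) (hex : ∃ β : L, IsKNormal K k β) :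
    ∃ α : Lˣ, IsKNormal K k (α : L) ∧ kNormalOrderBound k q n ≤ (orderOf α : ℝ) := by
  classical
  obtain ⟨β, hβ⟩ := hex
  have : FiniteDimensional K L := Module.finite_of_finrank_pos (by omega)
  have : Finite L := Module.finite_of_finite K
  let := Fintype.ofFinite L
  have hq2 : 2 ≤ q := hq ▸ Finite.one_lt_card
  have hkn : k < Module.finrank K L := by omega
  by_contra! hcon
  set S : Finset Lˣ := Finset.univ.filter fun α => IsKNormal K k (α : L) with hS
  have hcard : (q - 1) ^ (n - k) ≤ S.card := by
    rw [← hq, ← hL]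
    refine (sub_one_pow_le_ncard_isKNormal K hβ).trans ?_
    rw [← Set.ncard_coe_finset S, ← Set.ncard_image_of_injective _ Units.val_injective]
    refine Set.ncard_le_ncard ?_ (Set.toFinite _)
    intro α hα
    exact ⟨Units.mk0 α (hα.ne_zero hkn), by simpa [hS] using hα, rfl⟩
  have hne : S.Nonempty :=
    Finset.card_pos.mp ((pow_pos (by omega : 0 < q - 1) _).trans_le hcard)
  have hlt := IsCyclic.card_lt_mul_card_divisors hne
    (T := kNormalOrderBound k q n) fun α hα => hcon α (Finset.mem_filter.mp hα).2
  have hunits : Nat.card Lˣ = q ^ n - 1 := by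
    rw [Nat.card_units, Module.natCard_eq_pow_finrank (K := K), hq, hL]
  rw [hunits] at hlt
  have hle := kNormalOrderBound_mul_card_divisors_le hq2 hn (by omega : k ≤ n)
  have hcard' : (((q - 1) ^ (n - k) : ℕ) : ℝ) ≤ S.card := by exact_mod_cast hcard
  linarith
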